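/- Let $n\ge 1$ and write permutations in one-line notation $\pi=[\pi_1,\dots,\pi_n]\in S_n$, with the convention $\pi_{n+1}=\pi_1$. A position $i\in\{1,\dots,n\}$ carries a cyclic bond of $\pi$ if $|\pi_i-\pi_{i+1}|=1$; the bond is the pair formed by $\pi_i$ and $\pi_{i+1}$. Let $a_{n,k}$ be the number of $\pi\in S_n$ with exactly $k$ cyclic bonds, where bonds are counted as unordered pairs $\{\pi_i,\pi_{i+1}\}$ (so that each permutation in $S_2$ has one cyclic bond), and put $H(z,u)=\sum_{n\ge 1}\sum_{k\ge 0}a_{n,k}z^nu^k$. Then, as formal power series with integer coefficients in $z$ and $u$, $$H(z,u)=-2z^2(u-1)+\sum_{m\ge 1}m!\,z^{m-1}\left(\frac{1+z(u-1)}{1-z(u-1)}\right)^{m-1}\left(z+\frac{2z\left(2z(u-1)-(z(u-1))^2\right)}{(1-z(u-1))^2}\right),$$ where the infinite sum converges coefficientwise. If instead bonds are counted by their positions $i$ (so that each permutation in $S_2$ has two cyclic bonds, while nothing changes for $n\neq 2$), the same formula holds for the corresponding generating function with the first term $-2z^2(u-1)$ replaced by $2z^2(u-1)^2$. -/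

import Mathlib

open scoped PowerSeries.WithPiTopology Nat

/-- The unordered pair formed by the entries of `π` in position `i` and in the cyclically next
position (the successor of the last position is the first one). -/
def cyclicPair {n : ℕ} (π : Equiv.Perm (Fin n)) (i : Fin n) : Sym2 (Fin n) :=
  s(π i, π (finRotate n i))

/-- There is a cyclic bond in position `i` of `π`: the entry there and the cyclically next entry
are two numbers that differ by exactly `1`. (The entries are `0, …, n - 1` instead of `1, …, n`,
which does not change differences. The first and last positions are treated as neighbours,
the smallest and largest values are not.) -/
def IsCyclicBond {n : ℕ} (π : Equiv.Perm (Fin n)) (i : Fin n) : Prop :=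
  |((π i : ℕ) : ℤ) - ((π (finRotate n i) : ℕ) : ℤ)| = 1

instance {n : ℕ} (π : Equiv.Perm (Fin n)) : DecidablePred (IsCyclicBond π) :=
  fun i => inferInstanceAs
    (Decidable (|((π i : ℕ) : ℤ) - ((π (finRotate n i) : ℕ) : ℤ)| = 1))

/-- The number of cyclic bonds, bonds being counted by their positions: each of the two
permutations of two letters has `2` of them. -/
def cbnd {n : ℕ} (π : Equiv.Perm (Fin n)) : ℕ :=
  (Finset.univ.filter (IsCyclicBond π)).card

/-- The number of cyclic bonds, bonds being counted as unordered pairs of entries: each of the two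
permutations of two letters has `1` of them. For `n ≠ 2` this is the same number as `cbnd`. -/
def cbndUnordered {n : ℕ} (π : Equiv.Perm (Fin n)) : ℕ :=
  ((Finset.univ.filter (IsCyclicBond π)).image (cyclicPair π)).card

/-- The ring `ℤ⟦u⟧⟦z⟧` of formal power series in `z` and `u`, with the topology of convergence of
every coefficient. -/
abbrev SeriesZU : Type := PowerSeries (PowerSeries ℤ)

namespace SeriesZU

/-- The variable `z`. -/
noncomputable def z : SeriesZU := PowerSeries.X

/-- The variable `u`. -/
noncomputable def u : SeriesZU := PowerSeries.C PowerSeries.X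

/-- The inverse of a series whose coefficient of `z ^ 0` is `1`. -/
noncomputable def inv (f : SeriesZU) : SeriesZU := PowerSeries.invOfUnit f 1

/-- The series `∑_{n ≥ 1} ∑_{k ≥ 0} a_{n,k} z ^ n u ^ k`, where `a_{n,k}` is the number of
permutations of `n` letters at which the statistic `s` takes the value `k`. -/
noncomputable def distribution (s : ∀ n : ℕ, Equiv.Perm (Fin n) → ℕ) : SeriesZU :=
  PowerSeries.mk fun n => PowerSeries.mk fun k =>
    if n = 0 then 0
    else (((Finset.univ.filter fun π : Equiv.Perm (Fin n) => s n π = k).card : ℕ) : ℤ)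

/-- The series that is summed over `m ≥ 1` in the formula for the distribution of cyclic bonds. -/
noncomputable def runTerm (m : ℕ) : SeriesZU :=
  (m ! : SeriesZU) * z ^ (m - 1)
    * ((1 + z * (u - 1)) * inv (1 - z * (u - 1))) ^ (m - 1)
    * (z + 2 * z * (2 * (z * (u - 1)) - (z * (u - 1)) ^ 2) * inv ((1 - z * (u - 1)) ^ 2))

end SeriesZU

/-!
Write `u = 1 + mark`. A permutation weighted by `u` to the number of its bonds is then a sum over
its sets of marked bonds. Except for the point where it is cut open, a permutation is a cyclic
arrangement of its entries, encoded by the full cycle `successor π` that sends each entry to the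
next one; a permutation of `N` letters is such a full cycle together with one of `N` cuts
(`sum_successor`).

Fix a set `E` of marked edges of the path of values, cutting the path into `m` blocks. The cyclic
arrangements in which the end points of every marked edge are neighbours number
`(m - 1)! * 2 ^ r`, where `r` is the number of blocks of size at least two
(`numArrangements_eq`). This is proved by induction, inserting a new smallest letter into a cyclic
arrangement: if the new edge is not marked, the letter may go anywhere except between the end points
of a marked edge, and if it is marked, the letter must go to one of the free sides of its neighbour.
The formula needs at least three letters. For two letters the two directions of a block coincide,
and this is where the term with `z ^ 2` comes from.

Let `f = z (1 + z * mark) / (1 - z * mark)` be the series of single blocks. Summing over `E`, the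
permutations of `N` letters contribute `∑ m, N * (m - 1)! * [z ^ N] f ^ m`
(`sum_numOrientations_eq`). Since `N * [z ^ N] f ^ m = [z ^ N] z (f ^ m)'` and
`z (f ^ m)' = m * f ^ (m - 1) * z f'`, this is the coefficient of `z ^ N` in the sum of
`m! * f ^ (m - 1) * z f'`, which is `runTerm m` (`runTerm_eq`).
-/

namespace CyclicBonds

open Equiv Equiv.Perm Finset

/-! ### Cyclic arrangements -/

/-- A permutation with a single orbit; fixed points occur only on a one-element type. -/
def IsFullCycle {α : Type*} (σ : Perm α) : Prop :=
  ∀ x y, σ.SameCycle x y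

/-- The values `i` and `i + 1` are neighbours in the cyclic arrangement with successor map `σ`. -/
def EdgeAdj {n : ℕ} (σ : Perm (Fin (n + 1))) (i : Fin n) : Prop :=
  σ i.castSucc = i.succ ∨ σ i.succ = i.castSucc

/-- Every marked edge of the path `0 — 1 — ⋯ — n` joins two neighbours of the cyclic arrangement
with successor map `σ`. -/
def Respects {n : ℕ} (σ : Perm (Fin (n + 1))) (E : Fin n → Bool) : Prop :=
  ∀ i, E i = true → EdgeAdj σ i

/-- A map that sends each arc of `τ` into an orbit of `e` sends orbits into orbits. With `e = 1` on
`Prop`, this says that a predicate preserved by `τ` is constant on orbits. -/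
theorem sameCycle_map {α β : Type*} {τ : Perm α} {e : Perm β} (g : α → β)
    (h : ∀ y, e.SameCycle (g y) (g (τ y))) {x y : α} (hxy : τ.SameCycle x y) :
    e.SameCycle (g x) (g y) := by
  obtain ⟨k, rfl⟩ := hxy
  induction k with
  | zero => simpa using SameCycle.refl _ _
  | succ k ih =>
    rw [add_comm, zpow_add, zpow_one, Perm.mul_apply]
    exact ih.trans (h _)
  | pred k ih =>
    refine ih.trans ?_
    have := h ((τ ^ (-(k : ℤ) - 1)) x)
    rw [← Perm.mul_apply, ← zpow_one_add] at this
    rw [show (1 : ℤ) + (-(k : ℤ) - 1) = -k by ring] at this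
    exact this.symm

theorem IsFullCycle.eq_univ_of_mapsTo {α : Type*} {σ : Perm α} (h : IsFullCycle σ) {s : Set α}
    {x : α} (hx : x ∈ s) (hs : ∀ y, y ∈ s ↔ σ y ∈ s) (y : α) : y ∈ s := by
  have := sameCycle_map (τ := σ) (e := (1 : Perm Prop)) (g := fun y => y ∈ s)
    (fun y => by simpa using hs y) (h x y)
  simpa [hx] using this

theorem IsFullCycle.apply_ne {n : ℕ} {σ : Perm (Fin (n + 2))} (h : IsFullCycle σ)
    (x : Fin (n + 2)) : σ x ≠ x := by
  intro hx
  obtain ⟨y, hy⟩ := exists_ne x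
  refine hy (h.eq_univ_of_mapsTo (s := {x}) rfl (fun z => ?_) y)
  simp only [Set.mem_singleton_iff]
  rw [← σ.injective.eq_iff (a := z), hx]

theorem IsFullCycle.apply_apply_ne {n : ℕ} {σ : Perm (Fin (n + 3))} (h : IsFullCycle σ)
    (x : Fin (n + 3)) : σ (σ x) ≠ x := by
  intro hx
  obtain ⟨y, hy⟩ : ∃ y, y ∉ ({x, σ x} : Finset (Fin (n + 3))) := by
    by_contra! hc
    have h1 := Finset.card_le_card (fun y _ => hc y : univ ⊆ ({x, σ x} : Finset (Fin (n + 3))))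
    have h2 := Finset.card_le_two (a := x) (b := σ x)
    simp at h1
    omega
  refine hy ?_
  have := h.eq_univ_of_mapsTo (s := {x, σ x}) (x := x) (by simp) (fun z => ?_) y
  · simpa using this
  · simp only [Set.mem_insert_iff, Set.mem_singleton_iff, σ.injective.eq_iff]
    rw [or_comm]
    refine or_congr ?_ Iff.rfl
    conv_rhs => rw [← hx, σ.injective.eq_iff]

/-! ### Inserting a smallest letter -/

/-- Inserting a new letter `0` immediately before `q` into the cyclic arrangement `e`, all letters
of which are shifted up by one. -/
abbrev insertZero {n : ℕ} (q : Fin n) (e : Perm (Fin n)) : Perm (Fin (n + 1)) :=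
  decomposeFin.symm (q.succ, e)

theorem insertZero_zero {n : ℕ} (q : Fin n) (e : Perm (Fin n)) : insertZero q e 0 = q.succ := by
  simp [insertZero]

theorem insertZero_succ {n : ℕ} (q : Fin n) (e : Perm (Fin n)) (x : Fin n) :
    insertZero q e x.succ = if e x = q then 0 else (e x).succ := by
  rw [insertZero, decomposeFin_symm_apply_succ, swap_apply_def]
  simp [Fin.succ_ne_zero]

theorem isFullCycle_insertZero {n : ℕ} (q : Fin n) (e : Perm (Fin n)) :
    IsFullCycle (insertZero q e) ↔ IsFullCycle e := by
  constructor
  · intro h x y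
    have := sameCycle_map (e := e) (g := fun z : Fin (n + 1) => Fin.cases q id z)
      (fun z => ?_) (h x.succ y.succ)
    · simpa using this
    · cases z using Fin.cases with
      | zero => simp [SameCycle.refl]
      | succ z =>
        rw [insertZero_succ]
        split_ifs with hz
        · simp [← hz, SameCycle.refl]
        · simp [SameCycle.refl]
  · intro h
    have key : ∀ x y : Fin n, (insertZero q e).SameCycle x.succ y.succ := fun x y => by
      refine sameCycle_map (e := insertZero q e) (g := Fin.succ) (fun z => ?_) (h x y)
      have h1 : (insertZero q e).SameCycle z.succ (insertZero q e z.succ) :=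
        sameCycle_apply_right.2 (SameCycle.refl _ _)
      rw [insertZero_succ] at h1
      split_ifs at h1 with hz
      · refine h1.trans ?_
        rw [hz, ← insertZero_zero q e]
        exact sameCycle_apply_right.2 (SameCycle.refl _ _)
      · exact h1
    have key0 : ∀ y : Fin n, (insertZero q e).SameCycle 0 y.succ := fun y => by
      refine SameCycle.trans ?_ (key q y)
      rw [← insertZero_zero q e]
      exact sameCycle_apply_right.2 (SameCycle.refl _ _)
    intro x y
    cases x using Fin.cases with
    | zero =>
      cases y using Fin.cases with
      | zero => exact SameCycle.refl _ _
      | succ y => exact key0 y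
    | succ x =>
      cases y using Fin.cases with
      | zero => exact (key0 x).symm
      | succ y => exact key x y

theorem edgeAdj_insertZero_succ {n : ℕ} (q : Fin (n + 1)) (e : Perm (Fin (n + 1))) (i : Fin n) :
    EdgeAdj (insertZero q e) i.succ ↔
      (e i.castSucc = i.succ ∧ q ≠ i.succ) ∨ (e i.succ = i.castSucc ∧ q ≠ i.castSucc) := by
  have aux : ∀ x y : Fin (n + 1),
      insertZero q e x.succ = y.succ ↔ e x = y ∧ q ≠ y := fun x y => by
    rw [insertZero_succ]
    split_ifs with h
    · simp only [(Fin.succ_ne_zero y).symm, false_iff, not_and, not_not]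
      rintro rfl
      exact h.symm
    · rw [Fin.succ_inj]
      refine ⟨fun hx => ⟨hx, ?_⟩, And.left⟩
      rintro rfl
      exact h hx
  rw [EdgeAdj, ← Fin.succ_castSucc, aux, aux]

theorem edgeAdj_insertZero_zero {n : ℕ} (q : Fin (n + 1)) (e : Perm (Fin (n + 1))) :
    EdgeAdj (insertZero q e) 0 ↔ q = 0 ∨ q = e 0 := by
  rw [EdgeAdj, insertZero_succ, Fin.castSucc_zero, insertZero_zero, Fin.succ_inj]
  refine or_congr Iff.rfl ?_
  split_ifs with h
  · simp [h]
  · simp [Fin.succ_ne_zero, Ne.symm h]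

/-- The head of the arc of the cyclic arrangement `e` that joins the values `i` and `i + 1`,
provided these are neighbours. Inserting a new letter before `q` breaks exactly the arc with
head `q`. -/
def arcHead {n : ℕ} (e : Perm (Fin (n + 1))) (i : Fin n) : Fin (n + 1) :=
  if e i.castSucc = i.succ then i.succ else i.castSucc

theorem edgeAdj_insertZero_succ_iff {n : ℕ} {q : Fin (n + 1)} {e : Perm (Fin (n + 1))}
    (he : ∀ x, e (e x) ≠ x) (i : Fin n) :
    EdgeAdj (insertZero q e) i.succ ↔ EdgeAdj e i ∧ q ≠ arcHead e i := by
  rw [edgeAdj_insertZero_succ, EdgeAdj, arcHead]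
  by_cases h : e i.castSucc = i.succ
  · have : e i.succ ≠ i.castSucc := by
      rw [← h]
      exact he _
    simp [h, this]
  · simp [h]

theorem arcHead_eq {n : ℕ} {e : Perm (Fin (n + 1))} {i : Fin n} (h : EdgeAdj e i) :
    (arcHead e i = i.succ ∧ e i.castSucc = i.succ) ∨
      (arcHead e i = i.castSucc ∧ e i.succ = i.castSucc) := by
  rw [arcHead]
  rcases h with h | h
  · simp [h]
  · by_cases h' : e i.castSucc = i.succ <;> simp [h, h']

theorem arcHead_injOn {n : ℕ} {e : Perm (Fin (n + 1))} {i j : Fin n}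
    (hi : EdgeAdj e i) (hj : EdgeAdj e j) (h : arcHead e i = arcHead e j) : i = j := by
  rcases arcHead_eq hi with ⟨h1, h2⟩ | ⟨h1, h2⟩ <;> rcases arcHead_eq hj with ⟨h3, h4⟩ | ⟨h3, h4⟩
  · exact Fin.succ_injective _ (h1 ▸ h3 ▸ h)
  · have h5 : i.succ = j.castSucc := h1 ▸ h3 ▸ h
    have h6 := e.injective (h2.trans (h5.trans h4.symm))
    simp only [Fin.ext_iff, Fin.val_succ, Fin.val_castSucc] at h5 h6
    omega
  · have h5 : i.castSucc = j.succ := h1 ▸ h3 ▸ h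
    have h6 := e.injective (h2.trans (h5.trans h4.symm))
    simp only [Fin.ext_iff, Fin.val_succ, Fin.val_castSucc] at h5 h6
    omega
  · exact Fin.castSucc_injective _ (h1 ▸ h3 ▸ h)

theorem respects_insertZero {n : ℕ} {q : Fin (n + 1)} {e : Perm (Fin (n + 1))}
    (he : ∀ x, e (e x) ≠ x) (b : Bool) (E : Fin n → Bool) :
    Respects (insertZero q e) (Fin.cons b E) ↔
      Respects e E ∧ (b = true → q = 0 ∨ q = e 0) ∧ ∀ i, E i = true → q ≠ arcHead e i := by
  rw [Respects, Fin.forall_fin_succ]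
  simp only [Fin.cons_zero, Fin.cons_succ, edgeAdj_insertZero_zero,
    edgeAdj_insertZero_succ_iff he, Respects]
  grind

/-! ### Counting arrangements with prescribed bonds -/

/-- The number of marked edges. -/
def numMarked {n : ℕ} (E : Fin n → Bool) : ℕ := (univ.filter fun i => E i = true).card

theorem numMarked_cons {n : ℕ} (b : Bool) (E : Fin n → Bool) :
    numMarked (Fin.cons b E : Fin (n + 1) → Bool) = (if b then 1 else 0) + numMarked E := by
  simp only [numMarked, Finset.card_filter, Fin.sum_univ_succ, Fin.cons_zero, Fin.cons_succ]

theorem numMarked_le {n : ℕ} (E : Fin n → Bool) : numMarked E ≤ n :=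
  (Finset.card_filter_le _ _).trans (by simp)

open Classical in
/-- The new letter may be inserted anywhere except into one of the marked arcs. -/
theorem card_insert_false {n : ℕ} {e : Perm (Fin (n + 1))} {E : Fin n → Bool}
    (hE : Respects e E) :
    (univ.filter fun q => ∀ i, E i = true → q ≠ arcHead e i).card = n + 1 - numMarked E := by
  have h : (univ.filter fun q => ∀ i, E i = true → q ≠ arcHead e i) =
      ((univ.filter fun i => E i = true).image (arcHead e))ᶜ := by
    ext q
    simp only [mem_filter, mem_univ, true_and, mem_compl, mem_image, not_exists, not_and]
    exact forall₂_congr fun i _ => ne_comm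
  rw [h, Finset.card_compl, Fintype.card_fin, Finset.card_image_of_injOn, numMarked]
  intro i hi j hj hij
  simp only [coe_filter, mem_univ, true_and, Set.mem_ofPred_eq] at hi hj
  exact arcHead_injOn (hE i hi) (hE j hj) hij

open Classical in
/-- If the edge to the new letter is marked too, the letter goes next to the letter that was smallest
so far, on either side unless one of them is taken by a marked edge. -/
theorem card_insert_true {n : ℕ} {e : Perm (Fin (n + 2))} {E : Fin (n + 1) → Bool}
    (he1 : ∀ x, e x ≠ x) (hE : Respects e E) :
    (univ.filter fun q => (q = 0 ∨ q = e 0) ∧ ∀ i, E i = true → q ≠ arcHead e i).card =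
      if E 0 then 1 else 2 := by
  have h0 : ∀ i, E i = true → arcHead e i = 0 → i = 0 := fun i hi h => by
    rcases arcHead_eq (hE i hi) with ⟨h1, -⟩ | ⟨h1, -⟩
    · exact absurd (h1.symm.trans h) (Fin.succ_ne_zero _)
    · exact Fin.castSucc_eq_zero_iff.1 (h1.symm.trans h)
  have h1 : ∀ i, E i = true → arcHead e i = e 0 → i = 0 := fun i hi h => by
    rcases arcHead_eq (hE i hi) with ⟨h1, h2⟩ | ⟨h1, h2⟩
    · exact Fin.castSucc_eq_zero_iff.1 (e.injective (h2.trans (h1.symm.trans h)))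
    · exact absurd (e.injective (h2.trans (h1.symm.trans h))) (Fin.succ_ne_zero _)
  by_cases hE0 : E 0 = true
  · rw [if_pos hE0, Finset.card_eq_one]
    rcases arcHead_eq (hE 0 hE0) with ⟨h2, h3⟩ | ⟨h2, h3⟩
    · refine ⟨0, ?_⟩
      rw [Fin.castSucc_zero] at h3
      ext q
      simp only [mem_filter, mem_univ, true_and, mem_singleton]
      constructor
      · rintro ⟨rfl | rfl, h⟩
        · rfl
        · exact absurd (h3.trans h2.symm) (h 0 hE0)
      · rintro rfl
        refine ⟨Or.inl rfl, fun i hi h => ?_⟩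
        rw [h0 i hi h.symm, h2] at h
        exact Fin.succ_ne_zero _ h.symm
    · refine ⟨e 0, ?_⟩
      rw [Fin.castSucc_zero] at h2 h3
      ext q
      simp only [mem_filter, mem_univ, true_and, mem_singleton]
      constructor
      · rintro ⟨rfl | rfl, h⟩
        · exact absurd h2.symm (h 0 hE0)
        · rfl
      · rintro rfl
        refine ⟨Or.inr rfl, fun i hi h => ?_⟩
        rw [h1 i hi h.symm, h2] at h
        exact he1 0 h
  · rw [if_neg hE0]
    have : (univ.filter fun q => (q = 0 ∨ q = e 0) ∧ ∀ i, E i = true → q ≠ arcHead e i) =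
        {0, e 0} := by
      ext q
      simp only [mem_filter, mem_univ, true_and, mem_insert, mem_singleton, and_iff_left_iff_imp]
      rintro (rfl | rfl) i hi h
      · exact hE0 (h0 i hi h.symm ▸ hi)
      · exact hE0 (h1 i hi h.symm ▸ hi)
    rw [this, Finset.card_pair (he1 0).symm]

open Classical in
/-- The number of cyclic arrangements of `0, …, n` in which the end points of every marked edge
are neighbours. -/
noncomputable def numArrangements {n : ℕ} (E : Fin n → Bool) : ℕ :=
  (univ.filter fun σ : Perm (Fin (n + 1)) => IsFullCycle σ ∧ Respects σ E).card

open Classical in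
theorem numArrangements_cons {n : ℕ} (b : Bool) (E : Fin (n + 2) → Bool) :
    numArrangements (Fin.cons b E : Fin (n + 3) → Bool) =
      ∑ e : Perm (Fin (n + 3)) with IsFullCycle e ∧ Respects e E,
        (univ.filter fun q => (b = true → q = 0 ∨ q = e 0) ∧
          ∀ i, E i = true → q ≠ arcHead e i).card := by
  rw [numArrangements, Finset.card_filter, ← decomposeFin.symm.sum_comp, Fintype.sum_prod_type,
    Finset.sum_comm, Finset.sum_filter]
  refine Finset.sum_congr rfl fun e _ => ?_
  rw [Fin.sum_univ_succ, if_neg, zero_add]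
  · by_cases hf : IsFullCycle e
    · simp only [isFullCycle_insertZero, hf, true_and, respects_insertZero hf.apply_apply_ne]
      split_ifs with hE
      · rw [Finset.card_filter]
        simp only [hE, true_and]
      · simp [hE]
    · simp [isFullCycle_insertZero, hf]
  · rintro ⟨h, -⟩
    exact h.apply_ne 0 (by simp)

theorem numArrangements_cons_false {n : ℕ} (E : Fin (n + 2) → Bool) :
    numArrangements (Fin.cons false E : Fin (n + 3) → Bool) =
      (n + 3 - numMarked E) * numArrangements E := by
  classical
  rw [numArrangements_cons, Finset.sum_congr rfl (g := fun _ => n + 3 - numMarked E), sum_const,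
    smul_eq_mul, mul_comm]
  · rfl
  · intro e he
    rw [← card_insert_false (mem_filter.1 he).2.2]
    simp

theorem numArrangements_cons_true {n : ℕ} (E : Fin (n + 2) → Bool) :
    numArrangements (Fin.cons true E : Fin (n + 3) → Bool) =
      (if E 0 then 1 else 2) * numArrangements E := by
  classical
  rw [numArrangements_cons, Finset.sum_congr rfl (g := fun _ => if E 0 then 1 else 2), sum_const,
    smul_eq_mul, mul_comm]
  · rfl
  · intro e he
    obtain ⟨h1, h2⟩ := (mem_filter.1 he).2
    rw [← card_insert_true h1.apply_ne h2]
    simp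

/-- Whether the first edge is marked; `false` if there is no edge. -/
def firstMarked : {n : ℕ} → (Fin n → Bool) → Bool
  | 0, _ => false
  | _ + 1, E => E 0

/-- `2` to the number of maximal runs of consecutive marked edges: every such run can be traversed
upwards or downwards. -/
def numOrientations : {n : ℕ} → (Fin n → Bool) → ℕ
  | 0, _ => 1
  | _ + 1, E => (if E 0 then if firstMarked (Fin.tail E) then 1 else 2 else 1) *
      numOrientations (Fin.tail E)

theorem numOrientations_cons {n : ℕ} (b : Bool) (E : Fin n → Bool) :
    numOrientations (Fin.cons b E : Fin (n + 1) → Bool) =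
      (if b then if firstMarked E then 1 else 2 else 1) * numOrientations E :=
  rfl

theorem isFullCycle_fin_three (σ : Perm (Fin 3)) :
    IsFullCycle σ ↔ σ = finRotate 3 ∨ σ = (finRotate 3)⁻¹ := by
  unfold IsFullCycle
  revert σ
  decide

theorem numArrangements_fin_two (E : Fin 2 → Bool) : numArrangements E = 2 := by
  classical
  have : (univ.filter fun σ : Perm (Fin 3) => IsFullCycle σ ∧ Respects σ E) =
      {finRotate 3, (finRotate 3)⁻¹} := by
    ext σ
    simp only [mem_filter, mem_univ, true_and, isFullCycle_fin_three, mem_insert, mem_singleton,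
      and_iff_left_iff_imp, Respects, EdgeAdj]
    rintro (rfl | rfl) i - <;> revert i <;> decide
  rw [numArrangements, this, Finset.card_pair (by decide)]

/-- The marked edges join the values into `n + 1 - numMarked E` blocks. These are arranged in a
cycle and each block of size at least two is read in one of two directions. For fewer than three
letters both directions give the same arrangement, and the formula fails. -/
theorem numArrangements_eq {n : ℕ} (E : Fin (n + 2) → Bool) :
    numArrangements E = (n + 2 - numMarked E)! * numOrientations E := by
  induction n with
  | zero =>
    rw [numArrangements_fin_two]
    revert E
    decide
  | succ n ih =>
    obtain ⟨b, E, rfl⟩ : ∃ b E', E = Fin.cons b E' := ⟨E 0, Fin.tail E, (Fin.cons_self_tail E).symm⟩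
    have hle := numMarked_le E
    cases b
    · rw [numArrangements_cons_false, ih, numMarked_cons, numOrientations_cons]
      obtain ⟨k, hk⟩ := Nat.exists_eq_add_of_le hle
      rw [show n + 3 - numMarked E = k + 1 by omega, show n + 2 - numMarked E = k by omega]
      rw [show n + 1 + 2 - ((if false = true then 1 else 0) + numMarked E) = k + 1 by simp; omega]
      simp [Nat.factorial_succ, mul_assoc]
    · rw [numArrangements_cons_true, ih, numMarked_cons, numOrientations_cons]
      rw [show n + 1 + 2 - ((if true = true then 1 else 0) + numMarked E) = n + 2 - numMarked E by
        simp; omega]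
      rw [if_pos rfl, mul_left_comm]
      rfl

end CyclicBonds

namespace CyclicBonds

open Equiv Equiv.Perm Finset

/-! ### Bonds of permutations -/

instance {n : ℕ} (σ : Perm (Fin (n + 1))) : DecidablePred (EdgeAdj σ) :=
  fun i => inferInstanceAs (Decidable (σ i.castSucc = i.succ ∨ σ i.succ = i.castSucc))

/-- The permutation that sends each entry of `π` to the cyclically next entry. -/
abbrev successor {n : ℕ} (π : Perm (Fin n)) : Perm (Fin n) := π * finRotate n * π⁻¹

theorem successor_apply {n : ℕ} (π : Perm (Fin n)) (i : Fin n) :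
    successor π (π i) = π (finRotate n i) := by
  simp [successor]

theorem isFullCycle_finRotate (n : ℕ) : IsFullCycle (finRotate (n + 2)) := fun x y =>
  isCycle_finRotate.sameCycle
    (mem_support.1 (by rw [support_finRotate]; exact mem_univ x))
    (mem_support.1 (by rw [support_finRotate]; exact mem_univ y))

theorem isFullCycle_successor {n : ℕ} (π : Perm (Fin (n + 2))) : IsFullCycle (successor π) :=
  fun _ _ => sameCycle_conj.2 (isFullCycle_finRotate n _ _)

theorem IsFullCycle.isCycle {n : ℕ} {σ : Perm (Fin (n + 2))} (h : IsFullCycle σ) : σ.IsCycle :=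
  ⟨0, h.apply_ne 0, fun y _ => h 0 y⟩

theorem IsFullCycle.support_eq {n : ℕ} {σ : Perm (Fin (n + 2))} (h : IsFullCycle σ) :
    σ.support = univ := by
  ext x
  simpa using h.apply_ne x

/-- Any full cycle is conjugate to the rotation, and powers of the rotation move the cut to any given
entry. -/
theorem successor_surj {n : ℕ} {σ : Perm (Fin (n + 2))} (h : IsFullCycle σ) (x : Fin (n + 2)) :
    ∃ π, successor π = σ ∧ π 0 = x := by
  obtain ⟨π, hπ⟩ := isConj_iff.1 (isCycle_finRotate.isConj h.isCycle
    (by rw [support_finRotate, h.support_eq]))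
  obtain ⟨k, hk⟩ := isFullCycle_finRotate n 0 (π⁻¹ x)
  refine ⟨π * finRotate (n + 2) ^ k, ?_, ?_⟩
  · rw [← hπ, successor]
    group
  · rw [Perm.mul_apply, hk]
    simp

theorem successor_inj {n : ℕ} {π π' : Perm (Fin (n + 2))} (h : successor π = successor π')
    (h0 : π 0 = π' 0) : π = π' := by
  ext1 i
  have := (isFullCycle_finRotate n 0 i)
  have h1 := sameCycle_map (e := (1 : Perm Prop)) (g := fun i => π i = π' i)
    (fun y => ?_) this
  · simpa [h0] using h1
  · rw [sameCycle_one, ← successor_apply, ← successor_apply, h, (successor π').injective.eq_iff]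

open Classical in
/-- Every cyclic arrangement is obtained from as many permutations as there are positions at which
it can be cut open. -/
theorem sum_successor {n : ℕ} {R : Type*} [CommRing R] (F : Perm (Fin (n + 2)) → R) :
    ∑ π, F (successor π) = (n + 2 : ℕ) * ∑ σ with IsFullCycle σ, F σ := by
  rw [← Finset.sum_fiberwise_of_maps_to (g := successor) (t := univ.filter IsFullCycle)
    (fun π _ => by simpa using isFullCycle_successor π), Finset.mul_sum]
  refine Finset.sum_congr rfl fun σ hσ => ?_
  have hσ : IsFullCycle σ := (mem_filter.1 hσ).2
  rw [Finset.sum_congr rfl (g := fun _ => F σ) (fun π hπ => by rw [(mem_filter.1 hπ).2]),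
    sum_const, nsmul_eq_mul]
  congr 2
  rw [Finset.card_nbij (t := univ) (fun π => π 0) (fun _ _ => mem_univ _) ?_ ?_, card_univ,
    Fintype.card_fin]
  · intro π hπ π' hπ' h
    simp only [coe_filter, mem_univ, true_and, Set.mem_ofPred_eq] at hπ hπ'
    exact successor_inj (hπ.trans hπ'.symm) h
  · intro x _
    obtain ⟨π, h, h'⟩ := successor_surj hσ x
    exact ⟨π, by simpa using h, h'⟩

/-- With at least three letters a pair of neighbouring values is adjacent in at most one position, so
counting positions amounts to counting edges of the path of values. -/
theorem cbnd_eq_card_edges {n : ℕ} (π : Perm (Fin (n + 3))) :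
    cbnd π = (univ.filter (EdgeAdj (successor π))).card := by
  set σ := successor π with hσ
  have hne := (isFullCycle_successor π).apply_apply_ne
  have h1 : cbnd π = (univ.filter fun x : Fin (n + 3) =>
      (σ x : ℕ) = x + 1 ∨ (x : ℕ) = σ x + 1).card := by
    rw [cbnd]
    -- The position `i` corresponds to its entry `π i`.
    refine Finset.card_nbij π (fun i hi => ?_) π.injective.injOn (fun x hx => ?_)
    · simp only [mem_filter, mem_univ, true_and, IsCyclicBond, mem_coe] at hi ⊢
      rw [abs_eq zero_le_one] at hi
      rw [hσ, successor_apply]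
      omega
    · obtain ⟨i, rfl⟩ := π.surjective x
      refine ⟨i, ?_, rfl⟩
      simp only [coe_filter, mem_univ, true_and, Set.mem_ofPred_eq, IsCyclicBond] at hx ⊢
      rw [hσ, successor_apply] at hx
      rw [abs_eq zero_le_one]
      omega
  rw [h1, filter_or, card_union_of_disjoint, show univ.filter (EdgeAdj σ) =
    univ.filter (fun i => σ i.castSucc = i.succ) ∪ univ.filter (fun i => σ i.succ = i.castSucc)
    from by ext i; simp [EdgeAdj], card_union_of_disjoint]
  · congr 1
    · symm
      refine Finset.card_nbij Fin.castSucc (fun i hi => ?_) (Fin.castSucc_injective _).injOn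
        (fun x hx => ?_)
      · simp only [mem_filter, mem_univ, true_and, mem_coe] at hi ⊢
        simp [hi]
      · simp only [coe_filter, mem_univ, true_and, Set.mem_ofPred_eq] at hx ⊢
        refine ⟨⟨x, by omega⟩, ?_, rfl⟩
        exact Fin.ext hx
    · symm
      refine Finset.card_nbij Fin.succ (fun i hi => ?_) (Fin.succ_injective _).injOn
        (fun x hx => ?_)
      · simp only [mem_filter, mem_univ, true_and, mem_coe] at hi ⊢
        simp [hi]
      · simp only [coe_filter, mem_univ, true_and, Set.mem_ofPred_eq] at hx ⊢
        have hx' : (⟨σ x, by omega⟩ : Fin (n + 2)).succ = x := Fin.ext hx.symm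
        refine ⟨⟨σ x, by omega⟩, ?_, hx'⟩
        simp only [Set.mem_ofPred_eq]
        rw [hx']
        rfl
  · rw [disjoint_filter]
    intro i _ h h'
    exact hne i.castSucc (by rw [h, h'])
  · rw [disjoint_filter]
    intro i _ h h'
    omega

theorem cbndUnordered_eq_cbnd {n : ℕ} (π : Perm (Fin (n + 3))) : cbndUnordered π = cbnd π := by
  refine Finset.card_image_of_injOn (Function.Injective.injOn fun i j hij => ?_)
  rw [cyclicPair, cyclicPair, Sym2.eq_iff] at hij
  rcases hij with ⟨h, -⟩ | ⟨h1, h2⟩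
  · exact π.injective h
  · exfalso
    have h2 := π.injective h2
    rw [π.injective h1] at h2
    exact (isFullCycle_finRotate (n + 1)).apply_apply_ne j h2

open Classical in
theorem one_add_pow_card_edgeAdj {n : ℕ} {R : Type*} [CommRing R] (v : R) (σ : Perm (Fin (n + 1))) :
    (1 + v) ^ (univ.filter (EdgeAdj σ)).card =
      ∑ E : Fin n → Bool, if Respects σ E then v ^ numMarked E else 0 := by
  have h : ∀ i : Fin n, (if EdgeAdj σ i then 1 + v else 1) =
      ∑ b : Bool, if b then if EdgeAdj σ i then v else 0 else 1 := fun i => by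
    rw [Fintype.sum_bool]
    split_ifs <;> simp_all [add_comm]
  rw [← Finset.prod_const, Finset.prod_filter, Finset.prod_congr rfl fun i _ => h i,
    Fintype.prod_sum]
  refine Finset.sum_congr rfl fun E _ => ?_
  split_ifs with hE
  · rw [numMarked, ← Finset.prod_const, Finset.prod_filter]
    refine Finset.prod_congr rfl fun i _ => ?_
    by_cases hi : E i = true
    · simp [hi, hE i hi]
    · simp [hi]
  · obtain ⟨i, hi, hi'⟩ : ∃ i, E i = true ∧ ¬ EdgeAdj σ i := by
      simpa [Respects] using hE
    exact Finset.prod_eq_zero (mem_univ i) (by simp [hi, hi'])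

theorem sum_pow_cbnd {n : ℕ} {R : Type*} [CommRing R] (v : R) :
    ∑ π : Perm (Fin (n + 3)), (1 + v) ^ cbnd π =
      (n + 3 : ℕ) * ∑ E : Fin (n + 2) → Bool,
        v ^ numMarked E * ((n + 2 - numMarked E)! * numOrientations E : ℕ) := by
  classical
  simp only [cbnd_eq_card_edges, one_add_pow_card_edgeAdj]
  rw [sum_successor (fun σ =>
    ∑ E : Fin (n + 2) → Bool, if Respects σ E then v ^ numMarked E else 0), Finset.sum_comm]
  congr 1
  refine Finset.sum_congr rfl fun E _ => ?_
  rw [← numArrangements_eq, numArrangements, ← Finset.sum_filter, Finset.filter_filter, sum_const,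
    nsmul_eq_mul, mul_comm]

end CyclicBonds

namespace CyclicBonds

open Finset PowerSeries

/-! ### Generating series of blocks -/

theorem sum_cons {M : Type*} [AddCommMonoid M] {n : ℕ} (F : (Fin (n + 1) → Bool) → M) :
    ∑ E, F E =
      ∑ E : Fin n → Bool, F (Fin.cons true E) + ∑ E : Fin n → Bool, F (Fin.cons false E) := by
  rw [← (Fin.consEquiv fun _ => Bool).sum_comp, Fintype.sum_prod_type, Fintype.sum_bool]
  rfl

section Runs

variable {R : Type*} [CommRing R]

/-- The weighted number of sets of marked edges of the path `0 — ⋯ — n` that cut it into `j + 1`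
blocks and in which the first edge is marked or not, as prescribed by `b`. -/
def blockSum (v : R) (n j : ℕ) (b : Bool) : R :=
  ∑ E : Fin n → Bool,
    if n - numMarked E = j ∧ firstMarked E = b then v ^ numMarked E * (numOrientations E : R) else 0

theorem blockSum_false_add_true (v : R) (n j : ℕ) :
    blockSum v n j false + blockSum v n j true =
      ∑ E : Fin n → Bool,
        if n - numMarked E = j then v ^ numMarked E * (numOrientations E : R) else 0 := by
  rw [blockSum, blockSum, ← Finset.sum_add_distrib]
  refine Finset.sum_congr rfl fun E _ => ?_
  cases firstMarked E <;> simp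

theorem blockSum_zero (v : R) (j : ℕ) (b : Bool) :
    blockSum v 0 j b = if j = 0 ∧ b = false then 1 else 0 := by
  rw [blockSum, Fintype.sum_unique]
  simp only [firstMarked, numMarked, numOrientations]
  cases b <;> simp [@eq_comm _ 0 j]

theorem firstMarked_cons {n : ℕ} (b : Bool) (E : Fin n → Bool) :
    firstMarked (Fin.cons b E : Fin (n + 1) → Bool) = b :=
  rfl

theorem blockSum_succ_zero_false (v : R) (n : ℕ) : blockSum v (n + 1) 0 false = 0 := by
  rw [blockSum, sum_cons]
  simp only [firstMarked_cons, numMarked_cons]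
  rw [Finset.sum_eq_zero, Finset.sum_eq_zero, add_zero]
  · intro E _
    have := numMarked_le E
    rw [if_neg]
    simp
    omega
  · intro E _
    simp

theorem blockSum_succ_succ_false (v : R) (n j : ℕ) :
    blockSum v (n + 1) (j + 1) false = blockSum v n j false + blockSum v n j true := by
  rw [blockSum_false_add_true, blockSum, sum_cons]
  simp only [firstMarked_cons, numMarked_cons, numOrientations_cons]
  rw [Finset.sum_eq_zero (fun E _ => by simp), zero_add]
  refine Finset.sum_congr rfl fun E _ => ?_
  have := numMarked_le E
  have h : n + 1 - numMarked E = j + 1 ↔ n - numMarked E = j := by omega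
  simp only [Bool.false_eq_true, if_false, zero_add, h, and_true, one_mul]

theorem blockSum_succ_true (v : R) (n j : ℕ) :
    blockSum v (n + 1) j true = v * (2 * blockSum v n j false + blockSum v n j true) := by
  rw [blockSum, blockSum, blockSum, sum_cons]
  simp only [firstMarked_cons, numMarked_cons, numOrientations_cons]
  rw [add_comm, Finset.sum_eq_zero (fun E _ => by simp), zero_add, Finset.mul_sum,
    ← Finset.sum_add_distrib, Finset.mul_sum]
  refine Finset.sum_congr rfl fun E _ => ?_
  have h : n + 1 - (1 + numMarked E) = j ↔ n - numMarked E = j := by omega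
  simp only [if_true, h]
  by_cases hj : n - numMarked E = j <;> cases firstMarked E <;> simp [hj, pow_add] <;> ring

/-- Here `g` is the series of blocks of at least two values: such a block is a shorter one with one
further value, and a block of two values arises in two directions. The block at the beginning of
the path is the factor on the right. -/
theorem coeff_pow_mul_eq_blockSum (v : R) {g : PowerSeries R}
    (hg : g = X * C v * (2 * X + g)) (n j : ℕ) :
    coeff (n + 1) ((X + g) ^ j * X) = blockSum v n j false ∧
      coeff (n + 1) ((X + g) ^ j * g) = blockSum v n j true := by
  have hg' : ∀ j n, coeff (n + 1) ((X + g) ^ j * g) =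
      v * (2 * coeff n ((X + g) ^ j * X) + coeff n ((X + g) ^ j * g)) := fun j n => by
    conv_lhs => rw [hg, show (X + X * C v * (2 * X + g)) = X + g by rw [← hg]]
    rw [show (X + g) ^ j * (X * C v * (2 * X + g)) =
      C v * (C 2 * ((X + g) ^ j * X) + (X + g) ^ j * g) * X by
        rw [map_ofNat]; ring, coeff_succ_mul_X, coeff_C_mul, map_add, coeff_C_mul]
  have hg0 : constantCoeff g = 0 := by rw [hg]; simp
  induction n generalizing j with
  | zero =>
    rw [hg', coeff_succ_mul_X, blockSum_zero, blockSum_zero]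
    simp [hg0, zero_pow_eq]
  | succ n ih =>
    rw [hg', (ih j).1, (ih j).2, blockSum_succ_true, coeff_succ_mul_X]
    refine ⟨?_, rfl⟩
    cases j with
    | zero => simp [blockSum_succ_zero_false, coeff_one]
    | succ j =>
      rw [blockSum_succ_succ_false, ← (ih j).1, ← (ih j).2, pow_succ, mul_add, map_add]

theorem sum_numOrientations_eq (v : R) {g : PowerSeries R} (hg : g = X * C v * (2 * X + g))
    (n : ℕ) :
    ∑ E : Fin n → Bool, v ^ numMarked E * ((n - numMarked E)! * numOrientations E : ℕ) =
      ∑ j ∈ range (n + 1), (j ! : R) * coeff (n + 1) ((X + g) ^ (j + 1)) := by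
  have h : ∀ j, coeff (n + 1) ((X + g) ^ (j + 1)) = ∑ E : Fin n → Bool,
      if n - numMarked E = j then v ^ numMarked E * (numOrientations E : R) else 0 := fun j => by
    rw [pow_succ, mul_add, map_add, (coeff_pow_mul_eq_blockSum v hg n j).1,
      (coeff_pow_mul_eq_blockSum v hg n j).2, blockSum_false_add_true]
  simp only [h, Finset.mul_sum]
  rw [Finset.sum_comm]
  refine Finset.sum_congr rfl fun E _ => ?_
  simp only [mul_ite, mul_zero]
  rw [Finset.sum_ite_eq, if_pos (by simp)]
  push_cast
  ring

/-- The identity `X (f ^ (m + 1))' = (m + 1) f ^ m X f'`, for the series `f` of blocks, with `f'`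
expressed through the inverse `q` of `1 - v X`. -/
theorem X_mul_derivative_pow (v : R) {q : PowerSeries R} (hq : (1 - X * C v) * q = 1) (m : ℕ) :
    X * d⁄dX R ((X * ((1 + X * C v) * q)) ^ (m + 1)) =
      (m + 1 : PowerSeries R) * (X * ((1 + X * C v) * q)) ^ m *
        (X + 2 * X * (2 * (X * C v) - (X * C v) ^ 2) * q ^ 2) := by
  set f := X * ((1 + X * C v) * q) with hf
  set w : PowerSeries R := X * C v with hw
  have h1 : f * (1 - w) = X * (1 + w) := by
    rw [hf]
    linear_combination (X * (1 + w)) * hq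
  have h2 : d⁄dX R f * (1 - w) = 1 + 2 * w + f * C v := by
    have := congrArg (d⁄dX R) h1
    simp only [hw, Derivation.leibniz, map_sub, map_add, derivative_X, derivative_C,
      smul_eq_mul, Derivation.map_one_eq_zero] at this
    linear_combination this
  have h3 : d⁄dX R f = 1 + 2 * (2 * w - w ^ 2) * q ^ 2 := by
    have h4 : d⁄dX R f * (1 - w) ^ 2 = (1 - w) ^ 2 + 2 * (2 * w - w ^ 2) := by
      linear_combination (1 - w) * h2 + C v * h1
    linear_combination q ^ 2 * h4 + (1 - d⁄dX R f) * (1 + (1 - w) * q) * hq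
  rw [Derivation.leibniz_pow, h3]
  simp only [smul_eq_mul, nsmul_eq_mul]
  push_cast
  ring

end Runs

end CyclicBonds

namespace CyclicBonds

open Finset PowerSeries SeriesZU

/-! ### The sum of `runTerm` and the distribution of bonds -/

/-- The variable that counts marked bonds: `u = 1 + mark`, since each bond may be marked or not. -/
noncomputable def mark : PowerSeries ℤ := X - 1

/-- The generating series `z (1 + z * mark) / (1 - z * mark)` of blocks of consecutive values, by
number of values and of marked bonds; blocks of at least two values come in two directions. -/
noncomputable def runSeries : SeriesZU := X * ((1 + X * C mark) * inv (1 - X * C mark))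

theorem z_mul_u_sub_one : z * (u - 1) = X * C mark := by
  rw [z, u, mark, map_sub, map_one]

theorem one_sub_mul_inv : (1 - X * C mark) * inv (1 - X * C mark : SeriesZU) = 1 :=
  mul_invOfUnit _ _ (by simp)

theorem inv_one_sub_sq :
    inv ((1 - X * C mark : SeriesZU) ^ 2) = inv (1 - X * C mark : SeriesZU) ^ 2 := by
  have h1 := one_sub_mul_inv
  have h2 : (1 - X * C mark : SeriesZU) ^ 2 * inv ((1 - X * C mark : SeriesZU) ^ 2) = 1 :=
    mul_invOfUnit _ _ (by simp)
  set a := inv ((1 - X * C mark : SeriesZU) ^ 2)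
  set q := inv (1 - X * C mark : SeriesZU)
  linear_combination q ^ 2 * h2 - a * (1 + (1 - X * C mark) * q) * h1

theorem runTerm_eq (m : ℕ) :
    runTerm (m + 1) = (m ! : SeriesZU) * (X * d⁄dX _ (runSeries ^ (m + 1))) := by
  rw [runSeries, X_mul_derivative_pow mark one_sub_mul_inv, runTerm, z_mul_u_sub_one,
    inv_one_sub_sq, Nat.factorial_succ, Nat.add_sub_cancel, z, mul_pow X (_ * _)]
  push_cast
  ring

theorem coeff_zero_runTerm (m : ℕ) : coeff 0 (runTerm (m + 1)) = 0 := by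
  simp [runTerm_eq]

theorem coeff_succ_runTerm (n m : ℕ) :
    coeff (n + 1) (runTerm (m + 1)) =
      (n + 1) * ((m ! : PowerSeries ℤ) * coeff (n + 1) (runSeries ^ (m + 1))) := by
  rw [runTerm_eq, ← map_natCast (C (R := PowerSeries ℤ)), coeff_C_mul, coeff_succ_X_mul,
    coeff_derivative]
  ring

theorem coeff_runTerm_eq_zero {n m : ℕ} (h : n ≤ m) : coeff n (runTerm (m + 1)) = 0 := by
  cases n with
  | zero => exact coeff_zero_runTerm m
  | succ n =>
    rw [coeff_succ_runTerm, runSeries, mul_pow, coeff_X_pow_mul', if_neg (by omega)]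
    simp

theorem hasSum_runTerm :
    HasSum (fun m : ℕ => runTerm (m + 1))
      (PowerSeries.mk fun n => ∑ m ∈ range n, coeff n (runTerm (m + 1))) := by
  rw [PowerSeries.WithPiTopology.hasSum_iff_hasSum_coeff]
  intro n
  rw [coeff_mk]
  refine hasSum_sum_of_ne_finset_zero fun m hm => ?_
  exact coeff_runTerm_eq_zero (by simpa using hm)

theorem coeff_zero_tsum_runTerm : coeff 0 (∑' m : ℕ, runTerm (m + 1)) = 0 := by
  rw [hasSum_runTerm.tsum_eq, coeff_mk]
  simp

theorem coeff_succ_tsum_runTerm (n : ℕ) :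
    coeff (n + 1) (∑' m : ℕ, runTerm (m + 1)) = (n + 1 : ℕ) * ∑ E : Fin n → Bool,
      mark ^ numMarked E * ((n - numMarked E)! * numOrientations E : ℕ) := by
  have hg : (runSeries - X) = X * C mark * (2 * X + (runSeries - X)) := by
    rw [runSeries]
    linear_combination (X + X * X * C mark) * one_sub_mul_inv
  rw [hasSum_runTerm.tsum_eq, coeff_mk, sum_numOrientations_eq mark hg, add_sub_cancel,
    Finset.mul_sum]
  simp only [coeff_succ_runTerm]
  push_cast
  rfl

theorem coeff_distribution (s : ∀ n : ℕ, Equiv.Perm (Fin n) → ℕ) (n : ℕ) :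
    coeff (n + 1) (distribution s) = ∑ π, (X : PowerSeries ℤ) ^ s (n + 1) π := by
  ext k
  rw [distribution, coeff_mk, coeff_mk, if_neg n.succ_ne_zero, map_sum, Finset.card_filter]
  push_cast
  exact Finset.sum_congr rfl fun π _ => by simp only [coeff_X_pow, eq_comm]

theorem coeff_zero_distribution (s : ∀ n : ℕ, Equiv.Perm (Fin n) → ℕ) :
    coeff 0 (distribution s) = 0 := by
  ext k
  simp [distribution]

theorem coeff_distribution_cbnd (n : ℕ) :
    coeff (n + 3) (distribution fun _ π => cbnd π) =
      coeff (n + 3) (∑' m : ℕ, runTerm (m + 1)) := by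
  rw [coeff_distribution, coeff_succ_tsum_runTerm, ← sum_pow_cbnd, mark, add_sub_cancel]

theorem coeff_one_tsum_runTerm : coeff 1 (∑' m : ℕ, runTerm (m + 1)) = 1 := by
  rw [coeff_succ_tsum_runTerm 0]
  simp [numMarked, numOrientations]

theorem coeff_two_tsum_runTerm : coeff 2 (∑' m : ℕ, runTerm (m + 1)) = 2 + 4 * mark := by
  rw [coeff_succ_tsum_runTerm 1, sum_cons, Fintype.sum_unique, Fintype.sum_unique]
  have h0 : ∀ E : Fin 0 → Bool, numMarked E = 0 := fun _ => rfl
  simp only [numMarked_cons, numOrientations_cons, h0]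
  simp [numOrientations, firstMarked]
  ring

/-- A statistic that agrees with `cbnd` on at least three letters is governed by `runTerm`, up to a
multiple `c` of `z ^ 2`. The series `2 + 4 * mark` would count four marked permutations of two
letters with the bond marked, as if the two directions of the only block gave different
arrangements; `c` is the difference to the actual contribution `p` of two letters. -/
theorem distribution_eq {s : ∀ n : ℕ, Equiv.Perm (Fin n) → ℕ} {c p : PowerSeries ℤ}
    (hc : p = c + 2 + 4 * mark)
    (h1 : ∑ π, (X : PowerSeries ℤ) ^ s 1 π = 1) (h2 : ∑ π, (X : PowerSeries ℤ) ^ s 2 π = p)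
    (h : ∀ n π, s (n + 3) π = cbnd π) :
    distribution s = C c * X ^ 2 + ∑' m : ℕ, runTerm (m + 1) := by
  refine PowerSeries.ext fun n => ?_
  rw [map_add, coeff_C_mul, coeff_X_pow]
  match n with
  | 0 => simp [coeff_zero_distribution, coeff_zero_tsum_runTerm]
  | 1 => rw [coeff_distribution s 0, h1, coeff_one_tsum_runTerm]; simp
  | 2 => rw [coeff_distribution s 1, h2, coeff_two_tsum_runTerm, hc]; simp [add_assoc]
  | n + 3 =>
    rw [← coeff_distribution_cbnd, coeff_distribution s (n + 2), coeff_distribution _ (n + 2)]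
    simp [h]

end CyclicBonds

theorem mainTheorem7 :
    Summable (fun m : ℕ => SeriesZU.runTerm (m + 1)) ∧
    SeriesZU.distribution (fun _ π => cbndUnordered π) =
      -2 * SeriesZU.z ^ 2 * (SeriesZU.u - 1) + ∑' m : ℕ, SeriesZU.runTerm (m + 1) ∧
    SeriesZU.distribution (fun _ π => cbnd π) =
      2 * SeriesZU.z ^ 2 * (SeriesZU.u - 1) ^ 2 + ∑' m : ℕ, SeriesZU.runTerm (m + 1) := by
  have hu : SeriesZU.u - 1 = PowerSeries.C CyclicBonds.mark := by
    rw [SeriesZU.u, CyclicBonds.mark, map_sub, map_one]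
  have hX : (PowerSeries.X : PowerSeries ℤ) = 1 + CyclicBonds.mark := by
    rw [CyclicBonds.mark, add_sub_cancel]
  refine ⟨CyclicBonds.hasSum_runTerm.summable, ?_, ?_⟩
  · rw [CyclicBonds.distribution_eq (c := -2 * CyclicBonds.mark) (p := 2 * PowerSeries.X)
      (by rw [hX]; ring) ?_ ?_ fun _ π => CyclicBonds.cbndUnordered_eq_cbnd π]
    · rw [hu, SeriesZU.z, map_mul, map_neg, map_ofNat]
      ring
    · rw [Finset.sum_congr rfl fun π _ => by
        rw [show cbndUnordered π = 0 by revert π; decide, pow_zero]]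
      simp
    · rw [Finset.sum_congr rfl fun π _ => by
        rw [show cbndUnordered π = 1 by revert π; decide, pow_one]]
      simp [Fintype.card_perm]
  · rw [CyclicBonds.distribution_eq (c := 2 * CyclicBonds.mark ^ 2) (p := 2 * PowerSeries.X ^ 2)
      (by rw [hX]; ring) ?_ ?_ fun _ _ => rfl]
    · rw [hu, SeriesZU.z, map_mul, map_pow, map_ofNat]
      ring
    · rw [Finset.sum_congr rfl fun π _ => by
        rw [show cbnd π = 0 by revert π; decide, pow_zero]]
      simp
    · rw [Finset.sum_congr rfl fun π _ => by
        rw [show cbnd π = 2 by revert π; decide]]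
      simp [Fintype.card_perm]
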